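/- For every integer $n\ge 1$ let $$a_n=\frac1n\sum_{k=0}^{n-1}\frac{\binom{n-1}{k}^2\binom{n+k}{k}^2}{4k^2-1}.$$ Call a real sequence $\{u_n\}$ asymptotically log-convex (respectively asymptotically log-concave) if there is $N$ such that for all $n\ge N$ one has $u_n>0$ and $u_{n+1}^2\le u_nu_{n+2}$ (respectively $u_nu_{n+2}\le u_{n+1}^2$). Then $\{a_n\}$ is asymptotically log-convex and $\{\sqrt[n]{a_n}\}$ is asymptotically log-concave. More precisely, there is $N\ge 1$ such that $a_n>0$ for all $n\ge N$, the sequence $\{a_{n+1}/a_n\}_{n\ge N}$ is strictly increasing, and the sequence $\{\sqrt[n+1]{a_{n+1}}/\sqrt[n]{a_n}\}_{n\ge N}$ is strictly decreasing. Moreover $$\lim_{n\to\infty}\frac{a_{n+1}}{a_n}=17+12\sqrt2\qquad\text{and}\qquad \lim_{n\to\infty}\frac{\sqrt[n+1]{a_{n+1}}}{\sqrt[n]{a_n}}=1.$$ -/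

import Mathlib

open Filter Topology

noncomputable section

/-- The sequence `a_n = (1/n) ∑_{k=0}^{n-1} C(n-1,k)² C(n+k,k)² / (4k² - 1)`, for `n ≥ 1`.
(The denominators `4k² - 1` never vanish, and the value at `n = 0` plays no role.) -/
def sunSeq (n : ℕ) : ℝ :=
  (1 / (n : ℝ)) * ∑ k ∈ Finset.range n,
    (((n - 1).choose k : ℝ) ^ 2 * ((n + k).choose k : ℝ) ^ 2) / (4 * (k : ℝ) ^ 2 - 1)

/-- The sequence of `n`-th roots of a sequence; it is used only at indices `n ≥ 1` with `u n > 0`. -/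
def nthRootSeq (u : ℕ → ℝ) (n : ℕ) : ℝ := u n ^ (1 / (n : ℝ))

/-- The sequence of consecutive ratios `u (n + 1) / u n`. -/
def ratioSeq (u : ℕ → ℝ) (n : ℕ) : ℝ := u (n + 1) / u n

/-- From some index on, the sequence is positive and satisfies `u_{n+1}² ≤ u_n u_{n+2}`. -/
def AsymptoticallyLogConvex (u : ℕ → ℝ) : Prop :=
  ∃ N : ℕ, ∀ n ≥ N, 0 < u n ∧ u (n + 1) ^ 2 ≤ u n * u (n + 2)

/-- From some index on, the sequence is positive and satisfies `u_n u_{n+2} ≤ u_{n+1}²`. -/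
def AsymptoticallyLogConcave (u : ℕ → ℝ) : Prop :=
  ∃ N : ℕ, ∀ n ≥ N, 0 < u n ∧ u n * u (n + 2) ≤ u (n + 1) ^ 2

end

/-! ### The recurrence, by creative telescoping -/

/-! Creative telescoping gives a third-order recurrence (`sunSeq_recurrence`), so the ratios `r n`
satisfy `r (n+2) = A - B / r (n+1) + C / (r (n+1) * r n)` with `A → 35`, `B → 35`, `C → 1`. Once `r
≥ 20`, this map damps earlier increments by a factor of at most about `35/400`, so the increments of
`r` are governed by those of `A`, of exact order `1/n²`. Hence `50/n² ≤ r (n+1) - r n ≤ 300/n²`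
propagates by induction (`increment_step`). The ratios therefore increase and are bounded, and their
limit is the root at least `20` of `(L - 1)(L² - 34L + 1)`.

For the roots, put `l = log u` and `d n = l (n+1) - l n`. The second difference of `l n / n` has the
sign of `2(l n - n d n) + n(n+1)(d (n+1) - d n)`. The upper bound on the increments keeps the last
term bounded; the lower bound sends `l n - n d n` to `-∞` through the harmonic series. -/

lemma choose_succ_mul_sub (n k : ℕ) :
    ((n + 1).choose k : ℝ) * (n + 1 - k) = n.choose k * (n + 1) := by
  rcases le_or_gt k (n + 1) with h | h
  · have := Nat.choose_mul_succ_eq n k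
    have h2 : (((n + 1 - k : ℕ)) : ℝ) = n + 1 - k := by
      rw [Nat.cast_sub h]; push_cast; ring
    rw [← h2]
    exact_mod_cast this.symm
  · rw [Nat.choose_eq_zero_of_lt h, Nat.choose_eq_zero_of_lt (by omega : n < k)]
    simp

lemma choose_succ_right_mul (n k : ℕ) :
    (n.choose (k + 1) : ℝ) * (k + 1) = n.choose k * (n - k) := by
  rcases le_or_gt k n with h | h
  · have := Nat.choose_succ_right_eq n k
    rw [← Nat.cast_sub h]
    exact_mod_cast this
  · rw [Nat.choose_eq_zero_of_lt h, Nat.choose_eq_zero_of_lt (by omega : n < k + 1)]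
    simp

lemma choose_add_succ_mul (n k : ℕ) :
    ((n + 1 + k).choose k : ℝ) * (n + 1) = (n + k).choose k * (n + 1 + k) := by
  have := choose_succ_mul_sub (n + k) k
  rw [show n + 1 + k = n + k + 1 by ring]
  push_cast at this
  linear_combination this

lemma choose_add_succ_succ_mul (n k : ℕ) :
    ((n + (k + 1)).choose (k + 1) : ℝ) * (k + 1) = (n + k).choose k * (n + 1 + k) := by
  have := Nat.add_one_mul_choose_eq (n + k) k
  have h : ((n : ℝ) + k + 1) * (n + k).choose k = (n + k + 1).choose (k + 1) * (k + 1) := by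
    exact_mod_cast this
  rw [show n + (k + 1) = n + k + 1 by ring]
  linear_combination -h

/-- The `k`-th summand of `sunSeq (p + 1)`. -/
noncomputable def sunTerm (p k : ℕ) : ℝ :=
  ((p.choose k : ℝ) * (p + 1 + k).choose k) ^ 2 / ((p + 1) * (4 * (k : ℝ) ^ 2 - 1))

/-- Summands with `k > p` vanish, so the four sums in the recurrence can share one range. -/
lemma sunSeq_succ_eq_sum (p M : ℕ) (h : p + 1 ≤ M) :
    sunSeq (p + 1) = ∑ k ∈ Finset.range M, sunTerm p k := by
  rw [← Finset.sum_subset (Finset.range_mono h)]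
  · rw [sunSeq, Finset.mul_sum]
    refine Finset.sum_congr rfl fun k _ => ?_
    rw [sunTerm, Nat.add_sub_cancel]
    push_cast
    rw [mul_pow, one_div_mul_eq_div, div_div, mul_comm (4 * (k : ℝ) ^ 2 - 1)]
  · intro k _ hk
    rw [sunTerm, Nat.choose_eq_zero_of_lt (by simpa using hk)]
    simp

/-- The numerator of the rational certificate. -/
def certPoly (x k : ℝ) : ℝ :=
  (-1440 - 8016 * x - 17856 * x ^ 2 - 21152 * x ^ 3 - 14640 * x ^ 4 - 5984 * x ^ 5
      - 1344 * x ^ 6 - 128 * x ^ 7)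
    + (60 + 544 * x + 1368 * x ^ 2 + 1264 * x ^ 3 + 480 * x ^ 4 + 64 * x ^ 5) * k
    + (600 + 2200 * x + 2664 * x ^ 2 + 1552 * x ^ 3 + 480 * x ^ 4 + 64 * x ^ 5) * k ^ 2
    + (-180 - 552 * x - 432 * x ^ 2 - 96 * x ^ 3) * k ^ 3

set_option maxHeartbeats 2000000 in
-- This is the telescoping relation with the common binomial factor and denominators cleared, where
-- `x = m + 1`.
lemma certPoly_identity (x k : ℝ) :
    -(x + 1) * (2 * x + 5) * (x + 1) ^ 2 * (x + 2) ^ 2 *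
        ((x - k) * (x + 1 - k) * (x + 2 - k)) ^ 2
      + (2 * x + 5) * (35 * x ^ 3 + 152 * x ^ 2 + 191 * x + 62) * (x + 2) ^ 2 *
        ((x + 1 + k) * (x + 1 - k) * (x + 2 - k)) ^ 2
      - (2 * x + 1) * (35 * x ^ 3 + 163 * x ^ 2 + 224 * x + 88) * (x + 1) ^ 2 *
        ((x + 1 + k) * (x + 2 + k) * (x + 2 - k)) ^ 2
      + (x + 2) * (2 * x + 1) * (x + 1) ^ 2 * (x + 2) ^ 2 *
        ((x + 1 + k) * (x + 2 + k) * (x + 3 + k)) ^ 2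
    = (2 * k - 1) * (x + k + 1) ^ 2 * (x + 2 - k) ^ 2 * certPoly x (k + 1)
      - (2 * k + 1) * k ^ 4 * certPoly x k := by
  unfold certPoly
  ring

/-- The telescoping companion of the summand. -/
noncomputable def certTerm (m k : ℕ) : ℝ :=
  ((m + 3).choose k * (m + 1 + k).choose k : ℝ) ^ 2 * (k : ℝ) ^ 4 * certPoly (m + 1) k /
    ((2 * k - 1) * ((m + 2) * (m + 3)) ^ 4)

lemma two_mul_natCast_sub_one_ne_zero (k : ℕ) : (2 * (k : ℝ) - 1) ≠ 0 := by
  intro h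
  have h2 : ((2 * k : ℕ) : ℝ) = (1 : ℕ) := by push_cast; linarith
  have h3 : 2 * k = 1 := by exact_mod_cast h2
  omega

lemma sunTerm_telescope (m k : ℕ) (x : ℝ) (hx : x = m + 1) :
    -x ^ 3 * (x + 1) * (2 * x + 5) * sunTerm m k
      + (2 * x + 5) * (x + 1) * (35 * x ^ 3 + 152 * x ^ 2 + 191 * x + 62) * sunTerm (m + 1) k
      - (2 * x + 1) * (x + 2) * (35 * x ^ 3 + 163 * x ^ 2 + 224 * x + 88) * sunTerm (m + 2) k
      + (x + 3) ^ 3 * (x + 2) * (2 * x + 1) * sunTerm (m + 3) k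
    = certTerm m (k + 1) - certTerm m k := by
  have hm : (m : ℝ) = x - 1 := by linarith
  have hx0 : 0 < x := by rw [hx]; positivity
  have a0 := choose_succ_mul_sub m k
  have a1 := choose_succ_mul_sub (m + 1) k
  have a2 := choose_succ_mul_sub (m + 2) k
  have b1 := choose_add_succ_mul (m + 1) k
  have b2 := choose_add_succ_mul (m + 2) k
  have b3 := choose_add_succ_mul (m + 3) k
  have e1 := choose_succ_right_mul (m + 3) k
  have e2 := choose_add_succ_succ_mul (m + 1) k
  have hk1 := two_mul_natCast_sub_one_ne_zero k
  have hk2 : (2 * (k : ℝ) + 1) ≠ 0 := by positivity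
  have hk3 : ((k : ℝ) + 1) ≠ 0 := by positivity
  have hk4 : 4 * (k : ℝ) ^ 2 - 1 = (2 * k - 1) * (2 * k + 1) := by ring
  have hk5 : 2 * ((k : ℝ) + 1) - 1 = 2 * k + 1 := by ring
  have n1 : x + 1 ≠ 0 := by positivity
  have n2 : x + 2 ≠ 0 := by positivity
  have n3 : x + 3 ≠ 0 := by positivity
  unfold certTerm sunTerm
  push_cast at *
  rw [hk4, hk5]
  -- Every binomial is reduced to `(m + 3).choose k` and `(m + 1 + k).choose k`; with this choice no
  -- denominator vanishes, even for `k > m`.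
  have c2 : ((m + 2).choose k : ℝ) = (m + 3).choose k * (x + 2 - k) / (x + 2) := by
    rw [eq_div_iff n2]; rw [hx]; linear_combination -a2
  have c1 : ((m + 1).choose k : ℝ) = (m + 2).choose k * (x + 1 - k) / (x + 1) := by
    rw [eq_div_iff n1]; rw [hx]; linear_combination -a1
  have c0 : (m.choose k : ℝ) = (m + 1).choose k * (x - k) / x := by
    rw [eq_div_iff hx0.ne']; rw [hx]; linear_combination -a0
  have d1 : ((m + 1 + 1 + k).choose k : ℝ) = (m + 1 + k).choose k * (x + 1 + k) / (x + 1) := by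
    rw [eq_div_iff n1]; rw [hx]; linear_combination b1
  have d2 : ((m + 2 + 1 + k).choose k : ℝ) = (m + 1 + 1 + k).choose k * (x + 2 + k) / (x + 2) := by
    rw [eq_div_iff n2]; rw [hx]; linear_combination b2
  have d3 : ((m + 3 + 1 + k).choose k : ℝ) = (m + 2 + 1 + k).choose k * (x + 3 + k) / (x + 3) := by
    rw [eq_div_iff n3]; rw [hx]; linear_combination b3
  have f1 : ((m + 3).choose (k + 1) : ℝ) = (m + 3).choose k * (x + 2 - k) / (k + 1) := by
    rw [eq_div_iff hk3]; rw [hx]; linear_combination e1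
  have f2 : ((m + 1 + (k + 1)).choose (k + 1) : ℝ)
      = (m + 1 + k).choose k * (x + 1 + k) / (k + 1) := by
    rw [eq_div_iff hk3]; rw [hx]; linear_combination e2
  rw [f1, f2, d3, d2, d1, c0, c1, c2]
  rw [show (m : ℝ) + 1 + 1 = x + 1 by linarith, show (m : ℝ) + 2 + 1 = x + 2 by linarith,
    show (m : ℝ) + 3 + 1 = x + 3 by linarith, show (m : ℝ) + 2 = x + 1 by linarith,
    show (m : ℝ) + 3 = x + 2 by linarith, ← hx]
  clear a0 a1 a2 b1 b2 b3 e1 e2 c0 c1 c2 d1 d2 d3 f1 f2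
  generalize ((m + 3).choose k : ℝ) = a
  generalize ((m + 1 + k).choose k : ℝ) = b
  have key := certPoly_identity x k
  generalize (k : ℝ) = k at *
  generalize certPoly x (k + 1) = q1 at *
  generalize certPoly x k = q0 at *
  have hx0' := hx0.ne'
  have key2 := congrArg
    (fun t => (a * b) ^ 2 / ((2 * k - 1) * (2 * k + 1) * ((x + 1) * (x + 2)) ^ 4) * t) key
  beta_reduce at key2
  rw [mul_add, mul_sub, mul_add, mul_sub] at key2
  convert key2 using 1
  · congr 1
    · congr 1
      · congr 1
        · field_simp
        · field_simp
      · field_simp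
    · field_simp
  · field_simp
    ring

/-- A coefficient of the recurrence, divided by the leading one. -/
noncomputable def recA (x : ℝ) : ℝ := (35 * x ^ 3 + 163 * x ^ 2 + 224 * x + 88) / (x + 3) ^ 3

/-- A coefficient of the recurrence, divided by the leading one. -/
noncomputable def recB (x : ℝ) : ℝ :=
  (2 * x + 5) * (x + 1) * (35 * x ^ 3 + 152 * x ^ 2 + 191 * x + 62) /
    ((x + 3) ^ 3 * (x + 2) * (2 * x + 1))

/-- A coefficient of the recurrence, divided by the leading one. -/
noncomputable def recC (x : ℝ) : ℝ :=
  x ^ 3 * (x + 1) * (2 * x + 5) / ((x + 3) ^ 3 * (x + 2) * (2 * x + 1))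

lemma sunSeq_recurrence (n : ℕ) (hn : 1 ≤ n) :
    sunSeq (n + 3) = recA n * sunSeq (n + 2) - recB n * sunSeq (n + 1) + recC n * sunSeq n := by
  obtain ⟨m, rfl⟩ : ∃ m, n = m + 1 := ⟨n - 1, by omega⟩
  rw [show m + 1 + 3 = (m + 3) + 1 by ring, show m + 1 + 2 = (m + 2) + 1 by ring,
    sunSeq_succ_eq_sum m (m + 4) (by omega), sunSeq_succ_eq_sum (m + 1) (m + 4) (by omega),
    sunSeq_succ_eq_sum (m + 2) (m + 4) (by omega), sunSeq_succ_eq_sum (m + 3) (m + 4) (by omega)]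
  obtain ⟨x, hx⟩ : ∃ x : ℝ, x = m + 1 := ⟨_, rfl⟩
  have hx0 : 0 < x := by rw [hx]; positivity
  -- Both ends vanish: `k ^ 4` at `k = 0`, and `(m + 3).choose k` at `k = m + 4`.
  have hsum : ∑ k ∈ Finset.range (m + 4), (certTerm m (k + 1) - certTerm m k) = 0 := by
    rw [Finset.sum_range_sub]
    simp [certTerm]
  rw [Finset.sum_congr rfl fun k _ => (sunTerm_telescope m k x hx).symm] at hsum
  rw [Finset.sum_add_distrib, Finset.sum_sub_distrib, Finset.sum_add_distrib,
    ← Finset.mul_sum, ← Finset.mul_sum, ← Finset.mul_sum, ← Finset.mul_sum] at hsum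
  rw [show ((m + 1 : ℕ) : ℝ) = x by rw [hx]; push_cast; rfl]
  unfold recA recB recC
  field_simp
  linear_combination hsum

/-! ### Bounds for the coefficients of the recurrence -/

section CoefficientBounds

variable {x : ℝ}

lemma recA_add_one_sub_bounds (hx : 9 ≤ x) :
    60 / x ^ 2 ≤ recA (x + 1) - recA x ∧ recA (x + 1) - recA x ≤ 160 / x ^ 2 := by
  -- After the shift by `9`, the cleared differences are polynomials in `y` with nonnegative
  -- coefficients.
  obtain ⟨y, hy, rfl⟩ : ∃ y : ℝ, 0 ≤ y ∧ x = y + 9 := ⟨x - 9, by linarith, by ring⟩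
  unfold recA
  rw [div_sub_div _ _ (by positivity) (by positivity)]
  constructor <;>
  · rw [div_le_div_iff₀ (by positivity) (by positivity), ← sub_nonneg]
    ring_nf
    positivity

lemma recB_add_one_sub_bounds (hx : 9 ≤ x) :
    0 ≤ recB (x + 1) - recB x ∧ recB (x + 1) - recB x ≤ 130 / x ^ 2 := by
  obtain ⟨y, hy, rfl⟩ : ∃ y : ℝ, 0 ≤ y ∧ x = y + 9 := ⟨x - 9, by linarith, by ring⟩
  unfold recB
  rw [div_sub_div _ _ (by positivity) (by positivity)]
  constructor
  · apply div_nonneg _ (by positivity)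
    ring_nf
    positivity
  · rw [div_le_div_iff₀ (by positivity) (by positivity), ← sub_nonneg]
    ring_nf
    positivity

lemma recC_add_one_sub_bounds (hx : 9 ≤ x) :
    0 ≤ recC (x + 1) - recC x ∧ recC (x + 1) - recC x ≤ 8 / x ^ 2 := by
  obtain ⟨y, hy, rfl⟩ : ∃ y : ℝ, 0 ≤ y ∧ x = y + 9 := ⟨x - 9, by linarith, by ring⟩
  unfold recC
  rw [div_sub_div _ _ (by positivity) (by positivity)]
  constructor
  · apply div_nonneg _ (by positivity)
    ring_nf
    positivity
  · rw [div_le_div_iff₀ (by positivity) (by positivity), ← sub_nonneg]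
    ring_nf
    positivity

lemma recA_le (hx : 0 ≤ x) : recA x ≤ 35 := by
  unfold recA
  rw [div_le_iff₀ (by positivity), ← sub_nonneg]
  ring_nf
  positivity

lemma recB_bounds (hx : 9 ≤ x) : 1 ≤ recB x ∧ recB x ≤ 35 := by
  obtain ⟨y, hy, rfl⟩ : ∃ y : ℝ, 0 ≤ y ∧ x = y + 9 := ⟨x - 9, by linarith, by ring⟩
  unfold recB
  rw [div_le_iff₀ (by positivity), le_div_iff₀ (by positivity), ← sub_nonneg,
    ← sub_nonneg (b := _ * _)]
  constructor <;>
  · ring_nf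
    positivity

lemma recC_bounds (hx : 0 ≤ x) : 0 ≤ recC x ∧ recC x ≤ 1 := by
  refine ⟨by unfold recC; positivity, ?_⟩
  unfold recC
  rw [div_le_one (by positivity), ← sub_nonneg]
  ring_nf
  positivity

end CoefficientBounds

lemma tendsto_inv_natCast : Tendsto (fun n : ℕ => ((n : ℝ))⁻¹) atTop (𝓝 0) :=
  tendsto_inv_atTop_zero.comp tendsto_natCast_atTop_atTop

lemma tendsto_recA : Tendsto (fun n : ℕ => recA n) atTop (𝓝 35) := by
  -- With `t = 1/n` the coefficient becomes a rational function continuous at `0`.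
  have h : ContinuousAt (fun t : ℝ =>
      (35 + 163 * t + 224 * t ^ 2 + 88 * t ^ 3) / (1 + 3 * t) ^ 3) 0 := by
    fun_prop (disch := norm_num)
  have h2 := h.tendsto.comp tendsto_inv_natCast
  norm_num at h2
  refine h2.congr' ?_
  filter_upwards [eventually_gt_atTop 0] with n hn
  have : (0 : ℝ) < n := by exact_mod_cast hn
  simp only [Function.comp, recA]
  field_simp

lemma tendsto_recB : Tendsto (fun n : ℕ => recB n) atTop (𝓝 35) := by
  have h : ContinuousAt (fun t : ℝ =>
      (2 + 5 * t) * (1 + t) * (35 + 152 * t + 191 * t ^ 2 + 62 * t ^ 3) /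
        ((1 + 3 * t) ^ 3 * (1 + 2 * t) * (2 + t))) 0 := by
    fun_prop (disch := norm_num)
  have h2 := h.tendsto.comp tendsto_inv_natCast
  norm_num at h2
  refine h2.congr' ?_
  filter_upwards [eventually_gt_atTop 0] with n hn
  have : (0 : ℝ) < n := by exact_mod_cast hn
  simp only [Function.comp, recB]
  field_simp

lemma tendsto_recC : Tendsto (fun n : ℕ => recC n) atTop (𝓝 1) := by
  have h : ContinuousAt (fun t : ℝ =>
      (1 + t) * (2 + 5 * t) / ((1 + 3 * t) ^ 3 * (1 + 2 * t) * (2 + t))) 0 := by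
    fun_prop (disch := norm_num)
  have h2 := h.tendsto.comp tendsto_inv_natCast
  norm_num at h2
  refine h2.congr' ?_
  filter_upwards [eventually_gt_atTop 0] with n hn
  have : (0 : ℝ) < n := by exact_mod_cast hn
  simp only [Function.comp, recC]
  field_simp

/-! ### The consecutive ratios -/

lemma ratio_recurrence {u0 u1 u2 u3 A B C : ℝ} (h1 : 0 < u1) (h2 : 0 < u2)
    (h : u3 = A * u2 - B * u1 + C * u0) :
    u3 / u2 = A - B / (u2 / u1) + C / (u2 / u1 * (u1 / u0)) := by
  rw [h]
  field_simp

/-- One step of the induction controlling the increments of the ratios. -/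
lemma increment_step {x r0 r1 r2 r3 : ℝ} (hx : 9 ≤ x) (h0 : 20 ≤ r0) (h1 : 20 ≤ r1)
    (h2 : 20 ≤ r2) (d0 : 0 ≤ r1 - r0) (d0' : r1 - r0 ≤ 300 / x ^ 2) (d1 : 0 ≤ r2 - r1)
    (d1' : r2 - r1 ≤ 300 / (x + 1) ^ 2)
    (e2 : r2 = recA x - recB x / r1 + recC x / (r1 * r0))
    (e3 : r3 = recA (x + 1) - recB (x + 1) / r2 + recC (x + 1) / (r2 * r1)) :
    50 / (x + 2) ^ 2 ≤ r3 - r2 ∧ r3 - r2 ≤ 300 / (x + 2) ^ 2 := by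
  obtain ⟨a1, a2⟩ := recA_add_one_sub_bounds hx
  obtain ⟨b1, b2⟩ := recB_add_one_sub_bounds hx
  obtain ⟨c1, c2⟩ := recC_add_one_sub_bounds hx
  obtain ⟨B1, B2⟩ := recB_bounds hx
  obtain ⟨C1, C2⟩ := recC_bounds (x := x) (by linarith)
  have p0 : 0 < r0 := by linarith
  have p1 : 0 < r1 := by linarith
  have p2 : 0 < r2 := by linarith
  have h12 : 20 * 20 ≤ r2 * r1 := mul_le_mul h2 h1 (by norm_num) p2.le
  have h012 : 20 * 20 * 20 ≤ r2 * r1 * r0 := mul_le_mul h12 h0 (by norm_num) (by positivity)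
  -- In units of `1/x²`, the terms below give at least `60 - 130/20 - 300/8000 > 50` and at most
  -- `160 + 35 * 300/400 + 8/400 < 190`.
  have e : r3 - r2 = (recA (x + 1) - recA x) - (recB (x + 1) - recB x) / r2
      + (recB x - recC x / r0) * (r2 - r1) / (r2 * r1) + (recC (x + 1) - recC x) / (r2 * r1)
      - recC x * (r1 - r0) / (r2 * r1 * r0) := by
    rw [e3]
    nth_rewrite 3 [e2]
    field_simp
    ring
  have hw : 0 ≤ 1 / x ^ 2 := by positivity
  have k1 : 300 / (x + 1) ^ 2 ≤ 300 / x ^ 2 := by gcongr; linarith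
  have k2 : 50 / (x + 2) ^ 2 ≤ 50 / x ^ 2 := by gcongr; linarith
  -- This uses `x ≥ 9`: `190 * 11² ≤ 300 * 9²`.
  have k3 : 190 / x ^ 2 ≤ 300 / (x + 2) ^ 2 := by
    rw [div_le_div_iff₀ (by positivity) (by positivity)]
    nlinarith
  have hC : recC x / r0 ≤ 1 := by rw [div_le_one p0]; linarith
  have hC' : 0 ≤ recC x / r0 := by positivity
  have t1 : (recB (x + 1) - recB x) / r2 ≤ 130 / x ^ 2 / 20 := by gcongr
  have t1' : 0 ≤ (recB (x + 1) - recB x) / r2 := by positivity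
  have t2 : (recB x - recC x / r0) * (r2 - r1) / (r2 * r1) ≤ 35 * (300 / x ^ 2) / (20 * 20) := by
    gcongr
    · linarith
    · linarith
  have t2' : 0 ≤ (recB x - recC x / r0) * (r2 - r1) / (r2 * r1) :=
    div_nonneg (mul_nonneg (by linarith) d1) (by positivity)
  have t3 : (recC (x + 1) - recC x) / (r2 * r1) ≤ 8 / x ^ 2 / (20 * 20) := by gcongr
  have t3' : 0 ≤ (recC (x + 1) - recC x) / (r2 * r1) := by positivity
  have t4 : recC x * (r1 - r0) / (r2 * r1 * r0) ≤ 1 * (300 / x ^ 2) / (20 * 20 * 20) := by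
    gcongr
  have t4' : 0 ≤ recC x * (r1 - r0) / (r2 * r1 * r0) := by positivity
  simp only [div_eq_mul_inv _ (x ^ 2)] at *
  constructor <;> linarith

lemma sunSeq_nine_to_twelve :
    sunSeq 9 = 39314175 ∧ sunSeq 10 = 802816213 ∧ sunSeq 11 = 17275712297 ∧
      sunSeq 12 = 387886408443 := by
  refine ⟨?_, ?_, ?_, ?_⟩ <;>
  · simp only [sunSeq, Finset.sum_range_succ, Finset.sum_range_zero]
    norm_num [Nat.choose]

lemma sunSeq_succ_pos {n : ℕ} (h : 0 < sunSeq n) (hr : 20 ≤ ratioSeq sunSeq n) :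
    0 < sunSeq (n + 1) := by
  have h2 : 0 < sunSeq (n + 1) / sunSeq n := by unfold ratioSeq at hr; linarith
  exact (div_pos_iff_of_pos_right h).1 h2

lemma ratioSeq_sunSeq_recurrence {n : ℕ} (hn : 1 ≤ n) (h1 : 0 < sunSeq (n + 1))
    (h2 : 0 < sunSeq (n + 2)) :
    ratioSeq sunSeq (n + 2) = recA n - recB n / ratioSeq sunSeq (n + 1)
        + recC n / (ratioSeq sunSeq (n + 1) * ratioSeq sunSeq n) :=
  ratio_recurrence h1 h2 (sunSeq_recurrence n hn)

/-- The recurrence for ratios has order two, so the induction carries two consecutive increments;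
exact values at `9` to `12` start it. -/
lemma sunSeq_pos_and_increment_bounds (n : ℕ) (hn : 9 ≤ n) :
    0 < sunSeq n ∧ 20 ≤ ratioSeq sunSeq n ∧
      (50 / (n : ℝ) ^ 2 ≤ ratioSeq sunSeq (n + 1) - ratioSeq sunSeq n ∧
      ratioSeq sunSeq (n + 1) - ratioSeq sunSeq n ≤ 300 / (n : ℝ) ^ 2) ∧
      50 / ((n : ℝ) + 1) ^ 2 ≤ ratioSeq sunSeq (n + 2) - ratioSeq sunSeq (n + 1) ∧
      ratioSeq sunSeq (n + 2) - ratioSeq sunSeq (n + 1) ≤ 300 / ((n : ℝ) + 1) ^ 2 := by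
  induction n, hn using Nat.le_induction with
  | base =>
    obtain ⟨h9, h10, h11, h12⟩ := sunSeq_nine_to_twelve
    simp only [ratioSeq, Nat.reduceAdd, h9, h10, h11, h12]
    norm_num
  | succ n hn ih =>
    obtain ⟨h0, r0, ⟨d0, d0'⟩, d1, d1'⟩ := ih
    have q0 : 0 ≤ 50 / (n : ℝ) ^ 2 := by positivity
    have q1 : 0 ≤ 50 / ((n : ℝ) + 1) ^ 2 := by positivity
    have r1 : 20 ≤ ratioSeq sunSeq (n + 1) := by linarith
    have r2 : 20 ≤ ratioSeq sunSeq (n + 2) := by linarith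
    have h1 := sunSeq_succ_pos h0 r0
    have h2 := sunSeq_succ_pos h1 r1
    have h3 := sunSeq_succ_pos h2 r2
    have e2 := ratioSeq_sunSeq_recurrence (n := n) (by omega) h1 h2
    have e3 := ratioSeq_sunSeq_recurrence (n := n + 1) (by omega) h2 h3
    push_cast at e3 ⊢
    have key := increment_step (x := n) (by exact_mod_cast hn) r0 r1 r2 (by linarith) d0'
      (by linarith) d1' e2 e3
    rw [show (n : ℝ) + 1 + 1 = n + 2 by ring]
    exact ⟨h1, r1, ⟨d1, d1'⟩, key⟩

lemma ratioSeq_sunSeq_le (n : ℕ) (hn : 9 ≤ n) : ratioSeq sunSeq n ≤ 36 := by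
  obtain ⟨h0, r0, ⟨d0, -⟩, d1, -⟩ := sunSeq_pos_and_increment_bounds n hn
  have q0 : 0 ≤ 50 / (n : ℝ) ^ 2 := by positivity
  have q1 : 0 ≤ 50 / ((n : ℝ) + 1) ^ 2 := by positivity
  have r1 : 20 ≤ ratioSeq sunSeq (n + 1) := by linarith
  have h1 := sunSeq_succ_pos h0 r0
  have e2 := ratioSeq_sunSeq_recurrence (n := n) (by omega) h1 (sunSeq_succ_pos h1 r1)
  have hA := recA_le (x := n) (by positivity)
  have hB := (recB_bounds (x := n) (by exact_mod_cast hn)).1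
  have hC := (recC_bounds (x := n) (by positivity)).2
  have t1 : 0 ≤ recB n / ratioSeq sunSeq (n + 1) := by positivity
  have t2 : recC n / (ratioSeq sunSeq (n + 1) * ratioSeq sunSeq n) ≤ 1 := by
    rw [div_le_one (by positivity)]
    nlinarith
  linarith

lemma tendsto_ratioSeq_sunSeq :
    Tendsto (ratioSeq sunSeq) atTop (𝓝 (17 + 12 * Real.sqrt 2)) := by
  have hmono : Monotone fun k => ratioSeq sunSeq (k + 9) := by
    refine monotone_nat_of_le_succ fun k => ?_
    have h := (sunSeq_pos_and_increment_bounds (k + 9) (by omega)).2.2.1.1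
    have q : 0 ≤ 50 / ((k + 9 : ℕ) : ℝ) ^ 2 := by positivity
    rw [show k + 1 + 9 = k + 9 + 1 by ring]
    linarith
  have hbdd : BddAbove (Set.range fun k => ratioSeq sunSeq (k + 9)) :=
    ⟨36, by rintro _ ⟨k, rfl⟩; exact ratioSeq_sunSeq_le _ (by omega)⟩
  obtain ⟨L, hL⟩ : ∃ L, Tendsto (ratioSeq sunSeq) atTop (𝓝 L) :=
    ⟨_, (tendsto_add_atTop_iff_nat 9).1 (tendsto_atTop_ciSup hmono hbdd)⟩
  have hL20 : 20 ≤ L := by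
    refine ge_of_tendsto hL ?_
    filter_upwards [eventually_ge_atTop 9] with n hn
    exact (sunSeq_pos_and_increment_bounds n hn).2.1
  have hL1 := (tendsto_add_atTop_iff_nat 1).2 hL
  have hL2 := (tendsto_add_atTop_iff_nat 2).2 hL
  have hlim := (tendsto_recA.sub (tendsto_recB.div hL1 (by positivity))).add
    (tendsto_recC.div (hL1.mul hL) (by positivity))
  have heq : L = 35 - 35 / L + 1 / (L * L) := by
    refine tendsto_nhds_unique (hL2.congr' ?_) hlim
    filter_upwards [eventually_ge_atTop 9] with n hn
    obtain ⟨h0, r0, ⟨d0, -⟩, -, -⟩ := sunSeq_pos_and_increment_bounds n hn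
    have q0 : 0 ≤ 50 / (n : ℝ) ^ 2 := by positivity
    have h1 := sunSeq_succ_pos h0 r0
    exact ratioSeq_sunSeq_recurrence (by omega) h1 (sunSeq_succ_pos h1 (by linarith))
  have hs : Real.sqrt 2 ^ 2 = 2 := Real.sq_sqrt (by norm_num)
  have hs0 := Real.sqrt_nonneg 2
  -- The limit equation is `L³ - 35L² + 35L - 1 = 0`; `L ≥ 20` rules out the roots `1` and `17 -
  -- 12√2`.
  have hfac : (L - 1) * (L - 17 + 12 * Real.sqrt 2) * (L - (17 + 12 * Real.sqrt 2)) = 0 := by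
    field_simp at heq
    linear_combination heq - 144 * (L - 1) * hs
  have : L = 17 + 12 * Real.sqrt 2 := by
    rcases mul_eq_zero.1 hfac with h | h
    · rcases mul_eq_zero.1 h with h | h
      · linarith
      · linarith
    · linarith
  rwa [← this]

/-! ### Sequences of roots -/

section Roots

variable {u : ℕ → ℝ} {N : ℕ}

lemma nthRootSeq_eq_exp {n : ℕ} (h : 0 < u n) : nthRootSeq u n = Real.exp (Real.log (u n) / n) := by
  rw [nthRootSeq, Real.rpow_def_of_pos h, mul_one_div]

lemma ratioSeq_nthRootSeq_eq_exp {n : ℕ} (h : 0 < u n) (h1 : 0 < u (n + 1)) :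
    ratioSeq (nthRootSeq u) n =
      Real.exp (Real.log (u (n + 1)) / (n + 1) - Real.log (u n) / n) := by
  rw [ratioSeq, nthRootSeq_eq_exp h, nthRootSeq_eq_exp h1, ← Real.exp_sub]
  push_cast
  rfl

lemma strictMonoOn_Ici_of_lt_succ {f : ℕ → ℝ} (h : ∀ n ≥ N, f n < f (n + 1)) :
    StrictMonoOn f (Set.Ici N) := by
  intro a ha b _ hab
  induction b, Nat.succ_le_of_lt hab using Nat.le_induction with
  | base => exact h a ha
  | succ b hb ih =>
    have hb' : a < b := hb
    have hNb : N ≤ b := le_trans ha hb'.le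
    exact (ih hNb hb').trans (h b hNb)

/-- Up to `log (u 0) / n`, `log (u n) / n` is the Cesàro mean of the differences of `log u`. Terms
before `N` may be nonpositive, but the telescoping holds for any values of `Real.log`. -/
lemma tendsto_nthRootSeq_of_tendsto_ratioSeq {L : ℝ} (hL : 0 < L) (hpos : ∀ n ≥ N, 0 < u n)
    (h : Tendsto (ratioSeq u) atTop (𝓝 L)) : Tendsto (nthRootSeq u) atTop (𝓝 L) := by
  have hd : Tendsto (fun n => Real.log (u (n + 1)) - Real.log (u n)) atTop (𝓝 (Real.log L)) := by
    refine ((Real.continuousAt_log hL.ne').tendsto.comp h).congr' ?_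
    filter_upwards [eventually_ge_atTop N] with n hn
    exact Real.log_div (hpos _ (by omega)).ne' (hpos _ hn).ne'
  have hc := hd.cesaro
  have h0 : Tendsto (fun n : ℕ => (n : ℝ)⁻¹ * Real.log (u 0)) atTop (𝓝 0) := by
    simpa using tendsto_inv_natCast.mul_const (Real.log (u 0))
  have hl := hc.add h0
  rw [add_zero] at hl
  have he := (Real.continuous_exp.tendsto _).comp hl
  rw [Real.exp_log hL] at he
  refine he.congr' ?_
  filter_upwards [eventually_ge_atTop N] with n hn
  rw [nthRootSeq_eq_exp (hpos n hn), Function.comp, Finset.sum_range_sub (fun i => Real.log (u i))]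
  congr 1
  ring

/-- If the increments of `d n = l (n + 1) - l n` are at least `m / n ^ 2` with `m > 0`, then
`l n - n * d n` tends to `-∞`. -/
lemma tendsto_sub_mul_diff_atBot {l : ℕ → ℝ} {m : ℝ} (hm : 0 < m)
    (h : ∀ n ≥ N, m / (n : ℝ) ^ 2 ≤ (l (n + 2) - l (n + 1)) - (l (n + 1) - l n)) :
    Tendsto (fun n : ℕ => l n - n * (l (n + 1) - l n)) atTop atBot := by
  set w : ℕ → ℝ := fun n => l n - n * (l (n + 1) - l n) with hw
  set M := N + 1 with hM
  -- Exactly, `w (n + 1) - w n` is `-(n + 1)` times the second difference of `l`.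
  have hstep : ∀ n ≥ M, w (n + 1) ≤ w n - m * (1 / ((n : ℝ) + 1)) := by
    intro n hn
    have hn0 : (0 : ℝ) < n := by exact_mod_cast (by omega : 0 < n)
    have h1 := h n (by omega)
    have h2 : m * (1 / ((n : ℝ) + 1)) ≤ (n + 1) * (m / (n : ℝ) ^ 2) := by
      rw [mul_one_div, mul_div_assoc', div_le_div_iff₀ (by positivity) (by positivity)]
      nlinarith [mul_pos hm hn0]
    have h3 := mul_le_mul_of_nonneg_left h1 (by positivity : (0 : ℝ) ≤ n + 1)
    simp only [hw]
    push_cast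
    rw [show n + 1 + 1 = n + 2 by ring]
    linarith
  have hle : ∀ n ≥ M, w n ≤ w M + m * ∑ i ∈ Finset.range M, 1 / ((i : ℝ) + 1)
      - m * ∑ i ∈ Finset.range n, 1 / ((i : ℝ) + 1) := by
    intro n hn
    induction n, hn using Nat.le_induction with
    | base => linarith
    | succ n hn ih =>
      rw [Finset.sum_range_succ (n := n), mul_add]
      linarith [hstep n hn]
  refine tendsto_atBot_mono' atTop (eventually_atTop.2 ⟨M, hle⟩) ?_
  have := Real.tendsto_sum_range_one_div_nat_succ_atTop.const_mul_atTop hm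
  exact tendsto_atBot_add_const_left atTop _ (tendsto_neg_atTop_atBot.comp this)

/-- If the increments of the ratios of a positive sequence are squeezed between positive
multiples of `1 / n ^ 2`, then the ratios of its roots eventually decrease strictly. -/
lemma exists_ratioSeq_nthRootSeq_lt {a b m K : ℝ} (ha : 0 < a) (hm : 0 < m)
    (hpos : ∀ n ≥ N, 0 < u n) (hra : ∀ n ≥ N, a ≤ ratioSeq u n) (hrb : ∀ n ≥ N, ratioSeq u n ≤ b)
    (hlow : ∀ n ≥ N, m / (n : ℝ) ^ 2 ≤ ratioSeq u (n + 1) - ratioSeq u n)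
    (hupp : ∀ n ≥ N, ratioSeq u (n + 1) - ratioSeq u n ≤ K / (n : ℝ) ^ 2) :
    ∃ N' ≥ N, ∀ n ≥ N', ratioSeq (nthRootSeq u) (n + 1) < ratioSeq (nthRootSeq u) n := by
  set l : ℕ → ℝ := fun n => Real.log (u n) with hl
  have hb : 0 < b := ha.trans_le ((hra N le_rfl).trans (hrb N le_rfl))
  have hd : ∀ n ≥ N, l (n + 1) - l n = Real.log (ratioSeq u n) := fun n hn =>
    (Real.log_div (hpos _ (by omega)).ne' (hpos _ hn).ne').symm
  have hlog : ∀ n ≥ N, (l (n + 2) - l (n + 1)) - (l (n + 1) - l n) =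
      Real.log (ratioSeq u (n + 1) / ratioSeq u n) := by
    intro n hn
    have h1 := hra n hn
    have h2 := hra (n + 1) (by omega)
    rw [hd (n + 1) (by omega), hd n hn, Real.log_div (by linarith) (by linarith)]
  -- The bounds pass to logarithms by `1 - 1/t ≤ log t ≤ t - 1` at the quotient of consecutive
  -- ratios.
  have hlow' : ∀ n ≥ N, m / b / (n : ℝ) ^ 2 ≤ (l (n + 2) - l (n + 1)) - (l (n + 1) - l n) := by
    intro n hn
    have p0 : 0 < ratioSeq u n := ha.trans_le (hra n hn)
    have p1 : 0 < ratioSeq u (n + 1) := ha.trans_le (hra (n + 1) (by omega))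
    have h1 := Real.one_sub_inv_le_log_of_pos (div_pos p1 p0)
    rw [hlog n hn]
    refine le_trans ?_ h1
    rw [inv_div, one_sub_div p1.ne', div_right_comm]
    have hq : 0 ≤ m / (n : ℝ) ^ 2 := by positivity
    exact div_le_div₀ (hq.trans (hlow n hn)) (hlow n hn) p1 (hrb _ (by omega))
  have hupp' : ∀ n ≥ N, (l (n + 2) - l (n + 1)) - (l (n + 1) - l n) ≤ K / a / (n : ℝ) ^ 2 := by
    intro n hn
    have p0 : 0 < ratioSeq u n := ha.trans_le (hra n hn)
    have p1 : 0 < ratioSeq u (n + 1) := ha.trans_le (hra (n + 1) (by omega))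
    have h1 := Real.log_le_sub_one_of_pos (div_pos p1 p0)
    rw [hlog n hn]
    refine h1.trans ?_
    rw [div_sub_one p0.ne', div_right_comm]
    have hq : 0 ≤ m / (n : ℝ) ^ 2 := by positivity
    exact div_le_div₀ ((hq.trans (hlow n hn)).trans (hupp n hn)) (hupp n hn) ha (hra n hn)
  have hbot := tendsto_sub_mul_diff_atBot (div_pos hm hb) hlow'
  -- The threshold `-(K / a)`, doubled, cancels the bound `2 * (K / a)` in `hkey`.
  obtain ⟨N', hN'⟩ := eventually_atTop.1 (hbot.eventually_lt_atBot (-(K / a)))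
  refine ⟨max (N + 1) N', by omega, fun n hn => ?_⟩
  have hnN : N ≤ n := by omega
  have hn1 : (1 : ℝ) ≤ n := by exact_mod_cast (by omega : 1 ≤ n)
  have hw := hN' n (by omega)
  have hu := hupp' n hnN
  have hK : 0 ≤ K / a / (n : ℝ) ^ 2 := le_trans (by positivity) ((hlow' n hnN).trans hu)
  rw [ratioSeq_nthRootSeq_eq_exp (hpos n hnN) (hpos _ (by omega)),
    ratioSeq_nthRootSeq_eq_exp (hpos _ (by omega)) (hpos _ (by omega)), Real.exp_lt_exp]
  push_cast
  change l (n + 2) / ((n : ℝ) + 1 + 1) - l (n + 1) / (n + 1) < l (n + 1) / (n + 1) - l n / n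
  have hkey : n * (n + 1) * ((l (n + 2) - l (n + 1)) - (l (n + 1) - l n)) ≤ 2 * (K / a) := by
    calc n * (n + 1) * ((l (n + 2) - l (n + 1)) - (l (n + 1) - l n))
        ≤ n * (n + 1) * (K / a / (n : ℝ) ^ 2) := by gcongr
      _ ≤ n * (n + n) * (K / a / (n : ℝ) ^ 2) := by gcongr
      _ = 2 * (K / a) := by field_simp; ring
  have hid : l (n + 2) / ((n : ℝ) + 1 + 1) - l (n + 1) / (n + 1) -
      (l (n + 1) / (n + 1) - l n / n) =
      (2 * (l n - n * (l (n + 1) - l n)) +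
        n * (n + 1) * ((l (n + 2) - l (n + 1)) - (l (n + 1) - l n))) /
        (n * (n + 1) * (n + 1 + 1)) := by
    field_simp
    ring
  rw [← sub_neg, hid]
  exact div_neg_of_neg_of_pos (by linarith) (by positivity)

end Roots

theorem mainTheorem1 :
    AsymptoticallyLogConvex sunSeq ∧
    AsymptoticallyLogConcave (nthRootSeq sunSeq) ∧
    (∃ N : ℕ, 1 ≤ N ∧ (∀ n ≥ N, 0 < sunSeq n) ∧
      StrictMonoOn (ratioSeq sunSeq) (Set.Ici N) ∧
      StrictAntiOn (ratioSeq (nthRootSeq sunSeq)) (Set.Ici N)) ∧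
    Tendsto (ratioSeq sunSeq) atTop (𝓝 (17 + 12 * Real.sqrt 2)) ∧
    Tendsto (ratioSeq (nthRootSeq sunSeq)) atTop (𝓝 1) := by
  have hpos : ∀ n ≥ 9, 0 < sunSeq n := fun n hn => (sunSeq_pos_and_increment_bounds n hn).1
  have hrpos : ∀ n ≥ 9, 0 < nthRootSeq sunSeq n := fun n hn => Real.rpow_pos_of_pos (hpos n hn) _
  have hlow : ∀ n : ℕ, n ≥ 9 → 50 / (n : ℝ) ^ 2 ≤ ratioSeq sunSeq (n + 1) - ratioSeq sunSeq n :=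
    fun n hn => (sunSeq_pos_and_increment_bounds n hn).2.2.1.1
  have hinc : ∀ n ≥ 9, ratioSeq sunSeq n < ratioSeq sunSeq (n + 1) := by
    intro n hn
    have hn0 : (0 : ℝ) < n := by exact_mod_cast (by omega : 0 < n)
    have : 0 < 50 / (n : ℝ) ^ 2 := by positivity
    linarith [hlow n hn]
  obtain ⟨N, hN, hdec⟩ := exists_ratioSeq_nthRootSeq_lt (N := 9) (by norm_num : (0 : ℝ) < 20)
    (by norm_num : (0 : ℝ) < 50) hpos (fun n hn => (sunSeq_pos_and_increment_bounds n hn).2.1)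
    ratioSeq_sunSeq_le hlow (fun n hn => (sunSeq_pos_and_increment_bounds n hn).2.2.1.2)
  have hL : (0 : ℝ) < 17 + 12 * Real.sqrt 2 := by positivity
  have hroot := tendsto_nthRootSeq_of_tendsto_ratioSeq hL hpos tendsto_ratioSeq_sunSeq
  refine ⟨⟨9, fun n hn => ⟨hpos n hn, ?_⟩⟩, ⟨N, fun n hn => ⟨hrpos n (by omega), ?_⟩⟩,
    ⟨N, by omega, fun n hn => hpos n (by omega),
      strictMonoOn_Ici_of_lt_succ fun n hn => hinc n (by omega), ?_⟩,
    tendsto_ratioSeq_sunSeq, ?_⟩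
  · have h := (hinc n hn).le
    rw [ratioSeq, ratioSeq, div_le_div_iff₀ (hpos _ hn) (hpos _ (by omega))] at h
    rw [sq]
    linarith
  · have h := (hdec n hn).le
    rw [ratioSeq, ratioSeq, div_le_div_iff₀ (hrpos _ (by omega)) (hrpos _ (by omega))] at h
    rw [sq]
    linarith
  · have h := strictMonoOn_Ici_of_lt_succ (f := fun n => -ratioSeq (nthRootSeq sunSeq) n)
      fun n hn => neg_lt_neg (hdec n hn)
    exact fun x hx y hy hxy => neg_lt_neg_iff.1 (h hx hy hxy)
  · have h := ((tendsto_add_atTop_iff_nat 1).2 hroot).div hroot hL.ne'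
    rwa [div_self hL.ne'] at h
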